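/- Let $N\ge 1$ and let $\mathcal C\subset\mathbb R^N$ be a symmetric polytope: the convex hull of finitely many points, with $\mathcal C=-\mathcal C$ and with the origin in its interior. Let $\mathcal C^\circ=\{z:\langle y,z\rangle\le 1\text{ for all }y\in\mathcal C\}$ be its polar, and write $\|x\|_{\mathcal C^\circ}=\inf\{\lambda>0: x\in\lambda\mathcal C^\circ\}$. Each vertex $y$ of $\mathcal C$ corresponds to the facet $\mathcal C^\circ\cap\{x:\langle y,x\rangle=1\}$ of $\mathcal C^\circ$. Let $h_y$ be the distance from the origin to the hyperplane $\{x:\langle y,x\rangle=1\}$ of this facet, and let $S_y$ be the $(N-1)$-dimensional area of the facet. Then $$P_Y(y)=\frac{h_yS_y}{N\,\mathrm{vol}(\mathcal C^\circ)}\qquad (y\text{ a vertex of }\mathcal C)$$ defines a probability distribution on the vertices of $\mathcal C$. Let $Y\sim P_Y$, let $\mathcal A\subseteq\mathbb R^N$ be a nonempty set, and put $$a:=\mathbb E\Big[\sup_{z\in\mathcal A}\langle z,Y\rangle\Big]\in(-\infty,+\infty].$$ Then: 1. if $a<\infty$, then $\mathrm{vol}(\mathcal A)\le\mathrm{vol}(a\,\mathcal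 C^\circ)$, where $\mathrm{vol}$ is the $N$-dimensional Lebesgue (outer) measure; 2. for every $l>0$, the $l$-packing number ${\sf P}_l(\mathcal A)$ of $\mathcal A$, that is, the largest cardinality of a set $S\subseteq\mathcal A$ with $\|x-x'\|_{\mathcal C^\circ}>l$ for all distinct $x,x'\in S$, satisfies $${\sf P}_l(\mathcal A)\le\Big(1+\frac{2a}{l}\Big)^N,$$ where the right-hand side is $+\infty$ if $a=+\infty$. -/

import Mathlib

open MeasureTheory ProbabilityTheory
open scoped InnerProductSpace ENNReal Pointwise

noncomputable section

/-- The polar `C° = {z : ⟨y, z⟩ ≤ 1 for all y ∈ C}`. -/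
def polarSet {N : ℕ} (C : Set (EuclideanSpace ℝ (Fin N))) : Set (EuclideanSpace ℝ (Fin N)) :=
  {z | ∀ y ∈ C, ⟪y, z⟫_ℝ ≤ 1}

/-- A symmetric full-dimensional polytope: the convex hull of finitely many points, symmetric
about the origin, with the origin in its interior. -/
structure IsSymmetricPolytope {N : ℕ} (C : Set (EuclideanSpace ℝ (Fin N))) : Prop where
  eq_convexHull : ∃ s : Set (EuclideanSpace ℝ (Fin N)), s.Finite ∧ C = convexHull ℝ s
  symm : -C = C
  zero_mem_interior : 0 ∈ interior C

/-- The hyperplane `{x : ⟨y, x⟩ = 1}`. For a vertex `y` of `C` it supports `C°`. -/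
def dualHyperplane {N : ℕ} (y : EuclideanSpace ℝ (Fin N)) : Set (EuclideanSpace ℝ (Fin N)) :=
  {x | ⟪y, x⟫_ℝ = 1}

/-- The facet of `C°` that corresponds to the vertex `y` of `C`. -/
def dualFacet {N : ℕ} (C : Set (EuclideanSpace ℝ (Fin N))) (y : EuclideanSpace ℝ (Fin N)) :
    Set (EuclideanSpace ℝ (Fin N)) :=
  polarSet C ∩ dualHyperplane y

/-- `h_y`: the distance from the origin to the hyperplane spanned by the facet of `y`. -/
def facetDistance {N : ℕ} (y : EuclideanSpace ℝ (Fin N)) : ℝ :=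
  Metric.infDist 0 (dualHyperplane y)

/-- `S_y`: the `(N-1)`-dimensional area of the facet of `y`. -/
def facetArea {N : ℕ} (C : Set (EuclideanSpace ℝ (Fin N))) (y : EuclideanSpace ℝ (Fin N)) : ℝ≥0∞ :=
  μHE[N - 1] (dualFacet C y)

/-- The law `P_Y` on the vertices of `C`: `P_Y(y) = h_y S_y / (N vol(C°))`. -/
def vertexLaw {N : ℕ} (C : Set (EuclideanSpace ℝ (Fin N))) :
    Measure (EuclideanSpace ℝ (Fin N)) :=
  Measure.sum fun y : C.extremePoints ℝ =>
    (ENNReal.ofReal (facetDistance y.1) * facetArea C y.1 / (N * volume (polarSet C))) •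
      Measure.dirac y.1

/-- The expectation `E[X⁺] - E[X⁻]` of an extended real random variable. -/
def extExpectation {Ω : Type*} [MeasurableSpace Ω] (P : Measure Ω) (X : Ω → EReal) : EReal :=
  ((∫⁻ ω, (X ω).toENNReal ∂P : ℝ≥0∞) : EReal) - ((∫⁻ ω, (-X ω).toENNReal ∂P : ℝ≥0∞) : EReal)

/-- The `l`-packing number of `A` for the norm with unit ball `K`, `‖x‖_K = inf {r > 0 : x ∈ r K}`:
the largest cardinality of a subset of `A` whose distinct points are more than `l` apart. -/
def convexPackingNumber {N : ℕ} (K : Set (EuclideanSpace ℝ (Fin N))) (l : ℝ)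
    (A : Set (EuclideanSpace ℝ (Fin N))) : ℕ∞ :=
  ⨆ (S : Set (EuclideanSpace ℝ (Fin N))) (_ : S ⊆ A)
    (_ : S.Pairwise fun x y => l < gauge K (x - y)), S.encard

end

/-! Cut `C°` into the cones with apex `0` over its facets. The cone over the facet of `y` has volume
`h_y S_y / N` (`volume_cone`, `volume_vertexCone`), so `P_Y(y)` is its share of `vol(C°)`. Hence the
weights sum to 1, and `a` is the weighted sum of the support function of `A` over the vertices.

The volume bound is then Minkowski's first inequality, obtained from Brunn–Minkowski by a first
variation. Scale so that `vol(A) = vol(C°)`. For small `t > 0` the set `(1 - t)C° + tA` has volume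
at least `vol(C°)`, and it is covered by the cones dilated by `1 + t(h(y) - 1)`, where `h` bounds
the support function of `A` (`volume_smul_add_smul_le`). Differentiating at `t = 0` gives `∑ P_Y(y)
h(y) ≥ 1` (`one_le_sum_of_volume_eq`). Brunn–Minkowski itself comes from Prékopa–Leindler, proved by
induction on the dimension.

For the packing bound, apply the same inequality to the union of the disjoint translates of
`(l/2)C°` centred at the packing points: passing from `A` to this union raises the support function
at a vertex by at most `l/2`. -/

/-! ### Volume of a cone over a piece of a hyperplane. -/

theorem lintegral_Ioc_ofReal_pow (n : ℕ) :
    ∫⁻ x in Set.Ioc (0 : ℝ) 1, ENNReal.ofReal (x ^ n) = ENNReal.ofReal (1 / (n + 1)) := by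
  rw [← ofReal_integral_eq_lintegral_ofReal]
  · rw [← intervalIntegral.integral_of_le zero_le_one, integral_pow]
    simp
  · exact (intervalIntegral.intervalIntegrable_pow n).1
  · filter_upwards [ae_restrict_mem measurableSet_Ioc] with x hx
    exact pow_nonneg hx.1.le n

theorem facetDistance_eq {N : ℕ} {y : EuclideanSpace ℝ (Fin N)} (hy : y ≠ 0) :
    facetDistance y = ‖y‖⁻¹ := by
  have hy' : ‖y‖ ≠ 0 := norm_ne_zero_iff.2 hy
  have hv : (‖y‖ ^ 2)⁻¹ • y ∈ dualHyperplane y := by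
    simp only [dualHyperplane, Set.mem_ofPred_eq, inner_smul_right, real_inner_self_eq_norm_sq]
    field_simp
  apply le_antisymm
  · refine (Metric.infDist_le_dist_of_mem hv).trans_eq ?_
    rw [dist_zero_left, norm_smul, norm_inv, norm_pow, norm_norm]
    field_simp
  · refine (Metric.le_infDist ⟨_, hv⟩).2 fun x hx => ?_
    rw [dist_zero_left, inv_le_iff_one_le_mul₀ (by positivity), mul_comm]
    calc 1 = ⟪y, x⟫_ℝ := hx.symm
      _ ≤ _ := real_inner_le_norm y x

/-- The volume of the cone with apex `0` over a measurable subset of a hyperplane. -/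
theorem volume_cone {N : ℕ} (hN : 1 ≤ N) {y : EuclideanSpace ℝ (Fin N)} (hy : y ≠ 0)
    {F : Set (EuclideanSpace ℝ (Fin N))} (hF : MeasurableSet F) (hFy : F ⊆ dualHyperplane y) :
    volume {x | 0 < ⟪y, x⟫_ℝ ∧ ⟪y, x⟫_ℝ ≤ 1 ∧ (⟪y, x⟫_ℝ)⁻¹ • x ∈ F} =
      ENNReal.ofReal (facetDistance y) * μHE[N - 1] F / N := by
  set T := {x | 0 < ⟪y, x⟫_ℝ ∧ ⟪y, x⟫_ℝ ≤ 1 ∧ (⟪y, x⟫_ℝ)⁻¹ • x ∈ F} with hT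
  have hy' : ‖y‖ ≠ 0 := norm_ne_zero_iff.2 hy
  have hTm : MeasurableSet T := by
    have h1 : Measurable fun x : EuclideanSpace ℝ (Fin N) => ⟪y, x⟫_ℝ := by fun_prop
    exact (measurableSet_lt measurable_const h1).inter
      ((measurableSet_le h1 measurable_const).inter ((h1.inv.smul measurable_id) hF))
  -- The foot of the perpendicular from `0` to the hyperplane, so `‖v‖` is the height of the cone.
  set v : EuclideanSpace ℝ (Fin N) := (‖y‖ ^ 2)⁻¹ • y with hv
  have hyv : ⟪y, v⟫_ℝ = 1 := by
    rw [hv, inner_smul_right, real_inner_self_eq_norm_sq]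
    field_simp
  have hv0 : v ≠ 0 := by
    rintro h
    simp [h] at hyv
  have hvn : ‖v‖ = ‖y‖⁻¹ := by
    rw [hv, norm_smul, norm_inv, norm_pow, norm_norm]
    field_simp
  have hmem : ∀ (x : ℝ) (z : EuclideanSpace ℝ (Fin N)),
      z ∈ AffineSubspace.mk' (x • v +ᵥ (0 : EuclideanSpace ℝ (Fin N))) (ℝ ∙ v)ᗮ ↔
        ⟪y, z⟫_ℝ = x := by
    intro x z
    rw [AffineSubspace.mem_mk', Submodule.mem_orthogonal_singleton_iff_inner_right, hv,
      real_inner_smul_left, mul_eq_zero, or_iff_right (by positivity)]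
    rw [vadd_eq_add, add_zero, vsub_eq_sub, inner_sub_right, inner_smul_right, ← hv, hyv]
    constructor <;> intro h <;> linarith
  -- Slice `T` orthogonally to `v`: the slice through `x • v` is `x • F` for `0 < x ≤ 1` and empty
  -- otherwise. Its area is `x ^ (N - 1)` times that of `F`, and integration produces the factor `1
  -- / N`.
  have key := EuclideanGeometry.euclideanHausdorffMeasure_eq_lintegral
    (0 : EuclideanSpace ℝ (Fin N)) hv0 hTm
  have hs : ∀ x : ℝ, μHE[N - 1]
      (T ∩ AffineSubspace.mk' (x • v +ᵥ (0 : EuclideanSpace ℝ (Fin N))) (ℝ ∙ v)ᗮ) =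
      (Set.Ioc (0 : ℝ) 1).indicator
        (fun x => ENNReal.ofReal (x ^ (N - 1)) * μHE[N - 1] F) x := by
    intro x
    by_cases hx : x ∈ Set.Ioc (0 : ℝ) 1
    · rw [Set.indicator_of_mem hx]
      have : T ∩ AffineSubspace.mk' (x • v +ᵥ (0 : EuclideanSpace ℝ (Fin N))) (ℝ ∙ v)ᗮ = x • F := by
        ext z
        rw [Set.mem_inter_iff, SetLike.mem_coe, hmem, Set.mem_smul_set_iff_inv_smul_mem₀ hx.1.ne']
        constructor
        · rintro ⟨⟨-, -, h⟩, rfl⟩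
          exact h
        · intro h
          have h1 := hFy h
          have h2 : ⟪y, z⟫_ℝ = x := by
            have : x⁻¹ * ⟪y, z⟫_ℝ = 1 := by rw [← inner_smul_right]; exact h1
            have hx0 := hx.1.ne'
            field_simp at this
            exact this
          exact ⟨by rw [hT, Set.mem_ofPred_eq, h2]; exact ⟨hx.1, hx.2, h⟩, h2⟩
      rw [this, Measure.euclideanHausdorffMeasure_smul₀ _ hx.1.ne', ENNReal.smul_def, smul_eq_mul,
        ENNReal.coe_pow, ENNReal.ofReal_pow hx.1.le]
      congr 2
      rw [← Real.enorm_of_nonneg hx.1.le]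
      rfl
    · rw [Set.indicator_of_notMem hx]
      convert measure_empty (μ := (μHE[N - 1] : Measure (EuclideanSpace ℝ (Fin N))))
      ext z
      rw [Set.mem_inter_iff, SetLike.mem_coe, hmem]
      simp only [Set.mem_empty_iff_false, iff_false]
      rintro ⟨⟨h1, h2, -⟩, rfl⟩
      exact hx ⟨h1, h2⟩
  rw [InnerProductSpace.euclideanHausdorffMeasure_eq_volume, finrank_euclideanSpace_fin] at key
  rw [key]
  simp_rw [hs]
  rw [lintegral_indicator measurableSet_Ioc, lintegral_mul_const _ (by fun_prop),
    lintegral_Ioc_ofReal_pow, facetDistance_eq hy, ← hvn, ← ofReal_norm,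
    ENNReal.div_eq_inv_mul]
  have : ENNReal.ofReal (1 / ((N - 1 : ℕ) + 1 : ℝ)) = (N : ℝ≥0∞)⁻¹ := by
    rw [Nat.cast_sub hN, Nat.cast_one, sub_add_cancel, one_div, ENNReal.ofReal_inv_of_pos
      (by exact_mod_cast hN), ENNReal.ofReal_natCast]
  rw [this]
  ring

/-! ### Prékopa–Leindler and Brunn–Minkowski inequalities. -/

/-- The translates `A + min B` and `max A + B` both lie in `A + B` and share only the point `max A +
min B`. -/
theorem volume_add_le_of_isCompact {A B : Set ℝ} (hA : IsCompact A) (hB : IsCompact B)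
    (hA0 : A.Nonempty) (hB0 : B.Nonempty) : volume A + volume B ≤ volume (A + B) := by
  obtain ⟨a, ha, hamax⟩ := hA.exists_isGreatest hA0
  obtain ⟨b, hb, hbmin⟩ := hB.exists_isLeast hB0
  have hd : AEDisjoint volume ((fun x => x + b) '' A) ((fun x => a + x) '' B) := by
    refine measure_mono_null (t := {a + b}) ?_ (by simp)
    rintro _ ⟨⟨x, hx, rfl⟩, y, hy, hxy⟩
    have h1 := hamax hx
    have h2 := hbmin hy
    simp only [Set.mem_singleton_iff] at *
    linarith
  calc volume A + volume B
      = volume ((fun x => x + b) '' A) + volume ((fun x => a + x) '' B) := by simp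
    _ = volume ((fun x => x + b) '' A ∪ (fun x => a + x) '' B) :=
      (measure_union₀ (hB.image (by fun_prop)).measurableSet.nullMeasurableSet hd).symm
    _ ≤ volume (A + B) := by
      refine measure_mono (Set.union_subset ?_ ?_)
      · rintro _ ⟨x, hx, rfl⟩
        exact Set.add_mem_add hx hb
      · rintro _ ⟨x, hx, rfl⟩
        exact Set.add_mem_add ha hx

theorem Real.volume_smul_of_pos {c : ℝ} (hc : 0 < c) (A : Set ℝ) :
    volume (c • A) = ENNReal.ofReal c * volume A := by
  rw [Measure.addHaar_smul, Module.finrank_self, pow_one, abs_of_pos hc]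

/-- The one-dimensional Brunn–Minkowski inequality. -/
theorem volume_add_volume_le {A B S : Set ℝ} (hA : MeasurableSet A) (hB : MeasurableSet B)
    (hA0 : A.Nonempty) (hB0 : B.Nonempty) {α β : ℝ} (hα : 0 < α) (hβ : 0 < β)
    (hS : ∀ x ∈ A, ∀ y ∈ B, α * x + β * y ∈ S) :
    ENNReal.ofReal α * volume A + ENNReal.ofReal β * volume B ≤ volume S := by
  obtain ⟨a, ha⟩ := hA0
  obtain ⟨b, hb⟩ := hB0
  rw [hA.measure_eq_iSup_isCompact, hB.measure_eq_iSup_isCompact]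
  simp_rw [ENNReal.mul_iSup, iSup_and']
  refine ENNReal.biSup_add_biSup_le' ⟨∅, by simp⟩ ⟨∅, by simp⟩ ?_
  rintro K ⟨hKA, hK⟩ L ⟨hLB, hL⟩
  -- The compact sets from inner regularity may be empty; adjoining `a` and `b` makes them nonempty.
  have hK' : IsCompact (α • insert a K) := (hK.insert a).smul α
  have hL' : IsCompact (β • insert b L) := (hL.insert b).smul β
  calc ENNReal.ofReal α * volume K + ENNReal.ofReal β * volume L
      ≤ volume (α • insert a K) + volume (β • insert b L) := by
        rw [Real.volume_smul_of_pos hα, Real.volume_smul_of_pos hβ]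
        gcongr <;> exact Set.subset_insert _ _
    _ ≤ volume (α • insert a K + β • insert b L) :=
        volume_add_le_of_isCompact hK' hL' ((Set.insert_nonempty _ _).smul_set)
          ((Set.insert_nonempty _ _).smul_set)
    _ ≤ volume S := by
        refine measure_mono ?_
        rintro _ ⟨_, ⟨x, hx, rfl⟩, _, ⟨y, hy, rfl⟩, rfl⟩
        exact hS x (Set.insert_subset ha hKA hx) y (Set.insert_subset hb hLB hy)

theorem ENNReal.geom_mean_le_arith_mean2 {α β : ℝ} (hα : 0 < α) (hβ : 0 < β) (hαβ : α + β = 1)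
    (a b : ℝ≥0∞) : a ^ α * b ^ β ≤ ENNReal.ofReal α * a + ENNReal.ofReal β * b := by
  have hpq : (α⁻¹).HolderConjugate β⁻¹ := by
    refine ⟨?_, inv_pos.2 hα, inv_pos.2 hβ⟩
    rw [inv_inv, inv_inv, hαβ, inv_one]
  refine (ENNReal.young_inequality (a ^ α) (b ^ β) hpq).trans_eq ?_
  rw [← ENNReal.rpow_mul, ← ENNReal.rpow_mul, mul_inv_cancel₀ hα.ne', mul_inv_cancel₀ hβ.ne',
    ENNReal.rpow_one, ENNReal.rpow_one, ENNReal.ofReal_inv_of_pos hα, ENNReal.ofReal_inv_of_pos hβ,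
    div_eq_mul_inv, div_eq_mul_inv, inv_inv, inv_inv, mul_comm, mul_comm b]

theorem lintegral_eq_lintegral_Ioi_of_le_one {F : ℝ → ℝ≥0∞} (hF : Measurable F)
    (hF1 : ∀ x, F x ≤ 1) :
    ∫⁻ x, F x = ∫⁻ t in Set.Ioi (0 : ℝ), volume {x | ENNReal.ofReal t < F x} := by
  have hfin : ∀ x, F x ≠ ∞ := fun x => ((hF1 x).trans_lt ENNReal.one_lt_top).ne
  have := lintegral_eq_lintegral_meas_lt (f := fun x => (F x).toReal) volume
    (.of_forall fun x => ENNReal.toReal_nonneg) hF.ennreal_toReal.aemeasurable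
  simp_rw [ENNReal.ofReal_toReal (hfin _)] at this
  rw [this]
  refine setLIntegral_congr_fun measurableSet_Ioi fun t ht => ?_
  simp_rw [ENNReal.ofReal_lt_iff_lt_toReal (le_of_lt ht) (hfin _)]

/-- The one-dimensional Prékopa–Leindler inequality for functions with supremum `1`. -/
theorem lintegral_add_lintegral_le_of_iSup_eq_one {F G H : ℝ → ℝ≥0∞} (hF : Measurable F)
    (hG : Measurable G) (hH : Measurable H) {α β : ℝ} (hα : 0 < α) (hβ : 0 < β) (hαβ : α + β = 1)
    (hF1 : ⨆ x, F x = 1) (hG1 : ⨆ x, G x = 1)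
    (h : ∀ x y, F x ^ α * G y ^ β ≤ H (α * x + β * y)) :
    ENNReal.ofReal α * (∫⁻ x, F x) + ENNReal.ofReal β * (∫⁻ x, G x) ≤ ∫⁻ x, H x := by
  -- Only levels `t < 1` matter, as `F` and `G` never exceed 1. There the superlevel sets of `F` and
  -- `G` are nonempty and their `α`, `β` combination lies in that of `H`, so one-dimensional
  -- Brunn–Minkowski applies level by level.
  have hm : Measurable fun x => min (H x) 1 := hH.min measurable_const
  have e1 := lintegral_eq_lintegral_Ioi_of_le_one hF fun x => (le_iSup F x).trans hF1.le
  have e2 := lintegral_eq_lintegral_Ioi_of_le_one hG fun x => (le_iSup G x).trans hG1.le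
  have e3 := lintegral_eq_lintegral_Ioi_of_le_one hm fun x => min_le_right _ _
  refine le_trans ?_ (lintegral_mono fun x => min_le_left (H x) 1)
  have anti : ∀ F : ℝ → ℝ≥0∞, Measurable fun t : ℝ => volume {x | ENNReal.ofReal t < F x} :=
    fun F => Antitone.measurable fun s t hst =>
      measure_mono fun x hx => lt_of_le_of_lt (ENNReal.ofReal_le_ofReal hst) hx
  rw [e3, e1, e2, ← lintegral_const_mul _ (anti F), ← lintegral_const_mul _ (anti G),
    ← lintegral_add_left ((anti F).const_mul _)]
  refine setLIntegral_mono (anti _) fun t ht => ?_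
  rcases lt_or_ge (ENNReal.ofReal t) 1 with ht1 | ht1
  · have ne : ∀ F : ℝ → ℝ≥0∞, ⨆ x, F x = 1 → {x | ENNReal.ofReal t < F x}.Nonempty :=
      fun F hF1 => by
        obtain ⟨x, hx⟩ := lt_iSup_iff.1 (ht1.trans_eq hF1.symm)
        exact ⟨x, hx⟩
    refine volume_add_volume_le (measurableSet_lt measurable_const hF)
      (measurableSet_lt measurable_const hG) (ne F hF1) (ne G hG1) hα hβ fun x hx y hy => ?_
    refine lt_min (lt_of_lt_of_le ?_ (h x y)) ht1
    calc ENNReal.ofReal t = ENNReal.ofReal t ^ α * ENNReal.ofReal t ^ β := by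
          rw [← ENNReal.rpow_add_of_nonneg _ _ hα.le hβ.le, hαβ, ENNReal.rpow_one]
      _ < F x ^ α * G y ^ β :=
          ENNReal.mul_lt_mul (ENNReal.rpow_lt_rpow hx hα) (ENNReal.rpow_lt_rpow hy hβ)
  · have e : ∀ F : ℝ → ℝ≥0∞, ⨆ x, F x = 1 → {x | ENNReal.ofReal t < F x} = ∅ := fun F hF1 => by
      ext x
      simpa using (le_iSup F x).trans (hF1.le.trans ht1)
    simp [e F hF1, e G hG1]

/-- Both sides scale alike, so `F` and `G` can be divided by their suprema and `H` by `M ^ α * L ^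
β`; weighted AM–GM then turns the additive bound into the multiplicative one. -/
theorem prekopaLeindler_real_of_bounded {F G H : ℝ → ℝ≥0∞} (hF : Measurable F)
    (hG : Measurable G) (hH : Measurable H) {α β : ℝ} (hα : 0 < α) (hβ : 0 < β) (hαβ : α + β = 1)
    (hFb : ⨆ x, F x ≠ ∞) (hGb : ⨆ x, G x ≠ ∞)
    (h : ∀ x y, F x ^ α * G y ^ β ≤ H (α * x + β * y)) :
    (∫⁻ x, F x) ^ α * (∫⁻ x, G x) ^ β ≤ ∫⁻ x, H x := by
  set M := ⨆ x, F x with hM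
  set L := ⨆ x, G x with hL
  by_cases hM0 : M = 0
  · have : ∀ x, F x = 0 := by simpa [hM] using hM0
    simp [this, hα]
  by_cases hL0 : L = 0
  · have : ∀ x, G x = 0 := by simpa [hL] using hL0
    simp [this, hβ]
  set c := M ^ α * L ^ β with hc
  have hMα : M ^ α ≠ 0 ∧ M ^ α ≠ ∞ := ⟨by simp [hM0, hα.not_gt], by simp [hFb, hM0]⟩
  have hLβ : L ^ β ≠ 0 ∧ L ^ β ≠ ∞ := ⟨by simp [hL0, hβ.not_gt], by simp [hGb, hL0]⟩
  have hc0 : c ≠ 0 := mul_ne_zero hMα.1 hLβ.1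
  have hct : c ≠ ∞ := ENNReal.mul_ne_top hMα.2 hLβ.2
  have e : ∀ u v : ℝ≥0∞, (M⁻¹ * u) ^ α * (L⁻¹ * v) ^ β = c⁻¹ * (u ^ α * v ^ β) := by
    intro u v
    rw [ENNReal.mul_rpow_of_nonneg _ _ hα.le, ENNReal.mul_rpow_of_nonneg _ _ hβ.le,
      ENNReal.inv_rpow, ENNReal.inv_rpow, hc,
      ENNReal.mul_inv (.inl hMα.1) (.inl hMα.2)]
    ring
  have key := (ENNReal.geom_mean_le_arith_mean2 hα hβ hαβ _ _).trans
    (lintegral_add_lintegral_le_of_iSup_eq_one (hF.const_mul M⁻¹) (hG.const_mul L⁻¹)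
      (hH.const_mul c⁻¹) hα hβ hαβ
      (by rw [← ENNReal.mul_iSup, ← hM, ENNReal.inv_mul_cancel hM0 hFb])
      (by rw [← ENNReal.mul_iSup, ← hL, ENNReal.inv_mul_cancel hL0 hGb])
      fun x y => by rw [e]; gcongr; exact h x y)
  rw [lintegral_const_mul _ hF, lintegral_const_mul _ hG, lintegral_const_mul _ hH, e] at key
  exact (ENNReal.mul_le_mul_iff_right (by simpa using hct) (by simpa using hc0)).1 key

theorem prekopaLeindler_real {F G H : ℝ → ℝ≥0∞} (hF : Measurable F)
    (hG : Measurable G) (hH : Measurable H) {α β : ℝ} (hα : 0 < α) (hβ : 0 < β) (hαβ : α + β = 1)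
    (h : ∀ x y, F x ^ α * G y ^ β ≤ H (α * x + β * y)) :
    (∫⁻ x, F x) ^ α * (∫⁻ x, G x) ^ β ≤ ∫⁻ x, H x := by
  by_cases hF0 : ∫⁻ x, F x = 0
  · simp [hF0, hα]
  by_cases hG0 : ∫⁻ x, G x = 0
  · simp [hG0, hβ]
  have mono : ∀ x : ℝ≥0∞, Monotone fun n : ℕ => min x n := fun x m n hmn =>
    min_le_min le_rfl (by exact_mod_cast hmn)
  have lim : ∀ x : ℝ≥0∞, Filter.Tendsto (fun n : ℕ => min x n) Filter.atTop (nhds x) := fun x => by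
    simpa using (tendsto_const_nhds (x := x)).min ENNReal.tendsto_nat_nhds_top
  have trunc : ∀ F : ℝ → ℝ≥0∞, Measurable F → Filter.Tendsto
      (fun n : ℕ => ∫⁻ x, min (F x) n) Filter.atTop (nhds (∫⁻ x, F x)) := fun F hF =>
    lintegral_tendsto_of_tendsto_of_monotone (fun n => (hF.min measurable_const).aemeasurable)
      (.of_forall fun x => mono (F x)) (.of_forall fun x => lim (F x))
  have hb : ∀ (F : ℝ → ℝ≥0∞) (n : ℕ), ⨆ x, min (F x) n ≠ ∞ := fun F n =>
    ((iSup_le fun x => min_le_right (F x) n).trans_lt (ENNReal.natCast_lt_top n)).ne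
  refine le_of_tendsto' (ENNReal.Tendsto.mul ((trunc F hF).ennrpow_const α) ?_
    ((trunc G hG).ennrpow_const β) ?_) fun n =>
    prekopaLeindler_real_of_bounded (hF.min measurable_const) (hG.min measurable_const) hH hα hβ
      hαβ (hb F n) (hb G n) fun x y => le_trans ?_ (h x y)
  · exact .inl (by simp [hF0, hα.not_gt])
  · exact .inl (by simp [hG0, hβ.not_gt])
  · gcongr <;> exact min_le_left _ _

/-- The **Prékopa–Leindler inequality**. -/
theorem prekopaLeindler (n : ℕ) {F G H : (Fin n → ℝ) → ℝ≥0∞} (hF : Measurable F)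
    (hG : Measurable G) (hH : Measurable H) {α β : ℝ} (hα : 0 < α) (hβ : 0 < β) (hαβ : α + β = 1)
    (h : ∀ x y, F x ^ α * G y ^ β ≤ H (α • x + β • y)) :
    (∫⁻ x, F x) ^ α * (∫⁻ x, G x) ^ β ≤ ∫⁻ x, H x := by
  induction n with
  | zero =>
    have hv : volume (Set.univ : Set (Fin 0 → ℝ)) = 1 := by simp [volume_pi]
    rw [lintegral_unique, lintegral_unique, lintegral_unique, hv, mul_one, mul_one, mul_one]
    exact (h _ _).trans_eq (congrArg H (Subsingleton.elim _ _))
  | succ n ih =>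
    have hcons : Measurable fun p : ℝ × (Fin n → ℝ) => (Fin.cons p.1 p.2 : Fin (n + 1) → ℝ) := by
      refine measurable_pi_lambda _ fun i => ?_
      refine Fin.cases ?_ (fun j => ?_) i
      · exact measurable_fst
      · exact (measurable_pi_apply j).comp measurable_snd
    have slice : ∀ F : (Fin (n + 1) → ℝ) → ℝ≥0∞, Measurable F →
        ∫⁻ x, F x = ∫⁻ s : ℝ, ∫⁻ w : Fin n → ℝ, F (Fin.cons s w) := by
      intro F hF
      rw [← (volume_preserving_piFinSuccAbove (fun _ : Fin (n + 1) => ℝ) 0).symm.lintegral_comp_emb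
        (MeasurableEquiv.measurableEmbedding _), Measure.volume_eq_prod]
      simp_rw [← Fin.insertNth_zero']
      exact lintegral_prod (μ := volume) (ν := volume) (fun p => F ((MeasurableEquiv.piFinSuccAbove (fun _ => ℝ) 0).symm p))
        (hF.comp (MeasurableEquiv.measurable _)).aemeasurable
    have meas : ∀ F : (Fin (n + 1) → ℝ) → ℝ≥0∞, Measurable F →
        Measurable fun s : ℝ => ∫⁻ w : Fin n → ℝ, F (Fin.cons s w) := fun F hF =>
      Measurable.lintegral_prod_right' (f := fun p : ℝ × (Fin n → ℝ) => F (Fin.cons p.1 p.2))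
        (hF.comp hcons)
    have meas' : ∀ F : (Fin (n + 1) → ℝ) → ℝ≥0∞, Measurable F → ∀ s : ℝ,
        Measurable fun w : Fin n → ℝ => F (Fin.cons s w) := fun F hF s =>
      (hF.comp hcons).comp measurable_prodMk_left
    rw [slice F hF, slice G hG, slice H hH]
    -- The integrals over the last `n` coordinates, as functions of the first, satisfy the
    -- one-dimensional hypothesis by the induction hypothesis.
    refine prekopaLeindler_real (meas F hF) (meas G hG) (meas H hH) hα hβ hαβ fun s t => ?_
    refine ih (meas' F hF s) (meas' G hG t) (meas' H hH _) fun x y => ?_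
    convert h (Fin.cons s x) (Fin.cons t y) using 2
    ext i
    refine Fin.cases ?_ (fun j => ?_) i <;> simp

/-- The multiplicative form of the **Brunn–Minkowski inequality** for compact sets. -/
theorem brunnMinkowski {N : ℕ} {A B : Set (EuclideanSpace ℝ (Fin N))} (hA : IsCompact A)
    (hB : IsCompact B) {α β : ℝ} (hα : 0 < α) (hβ : 0 < β) (hαβ : α + β = 1) :
    volume A ^ α * volume B ^ β ≤ volume (α • A + β • B) := by
  have hS : IsCompact (α • A + β • B) := (hA.smul α).add (hB.smul β)
  have vol : ∀ S : Set (EuclideanSpace ℝ (Fin N)), IsCompact S →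
      MeasurableSet (WithLp.toLp 2 ⁻¹' S : Set (Fin N → ℝ)) ∧
      volume S = ∫⁻ x : Fin N → ℝ, (WithLp.toLp 2 ⁻¹' S).indicator 1 x := by
    intro S hS
    have hm : MeasurableSet (WithLp.toLp 2 ⁻¹' S : Set (Fin N → ℝ)) :=
      (PiLp.volume_preserving_toLp (Fin N)).measurable hS.measurableSet
    refine ⟨hm, ?_⟩
    rw [lintegral_indicator_one hm,
      (PiLp.volume_preserving_toLp (Fin N)).measure_preimage hS.measurableSet.nullMeasurableSet]
  rw [(vol A hA).2, (vol B hB).2, (vol _ hS).2]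
  refine prekopaLeindler N (measurable_one.indicator (vol A hA).1)
    (measurable_one.indicator (vol B hB).1) (measurable_one.indicator (vol _ hS).1) hα hβ hαβ
    fun x y => ?_
  by_cases hx : x ∈ WithLp.toLp 2 ⁻¹' A
  · by_cases hy : y ∈ WithLp.toLp 2 ⁻¹' B
    · have : α • x + β • y ∈ WithLp.toLp 2 ⁻¹' (α • A + β • B) :=
        Set.add_mem_add (Set.smul_mem_smul_set hx) (Set.smul_mem_smul_set hy)
      simp [Set.indicator_of_mem hx, Set.indicator_of_mem hy, Set.indicator_of_mem this]
    · simp [Set.indicator_of_notMem hy, hβ]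
  · simp [Set.indicator_of_notMem hx, hα]

/-! ### The polytope and its polar body. -/

namespace IsSymmetricPolytope

variable {N : ℕ} {C : Set (EuclideanSpace ℝ (Fin N))}

theorem isCompact (hC : IsSymmetricPolytope C) : IsCompact C := by
  obtain ⟨s, hs, rfl⟩ := hC.eq_convexHull
  exact hs.isCompact_convexHull ℝ

theorem convex (hC : IsSymmetricPolytope C) : Convex ℝ C := by
  obtain ⟨s, hs, rfl⟩ := hC.eq_convexHull
  exact convex_convexHull ℝ s

theorem finite_extremePoints (hC : IsSymmetricPolytope C) : (C.extremePoints ℝ).Finite := by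
  obtain ⟨s, hs, rfl⟩ := hC.eq_convexHull
  exact hs.subset extremePoints_convexHull_subset

theorem zero_mem (hC : IsSymmetricPolytope C) : (0 : EuclideanSpace ℝ (Fin N)) ∈ C :=
  interior_subset hC.zero_mem_interior

theorem nonempty_extremePoints (hC : IsSymmetricPolytope C) : (C.extremePoints ℝ).Nonempty :=
  hC.isCompact.extremePoints_nonempty ⟨0, hC.zero_mem⟩

/-- Krein–Milman: a closed half-space containing the extreme points contains `C`. -/
theorem inner_le_of_forall_extremePoints (hC : IsSymmetricPolytope C)
    {x : EuclideanSpace ℝ (Fin N)} {r : ℝ} (h : ∀ v ∈ C.extremePoints ℝ, ⟪v, x⟫_ℝ ≤ r)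
    {c : EuclideanSpace ℝ (Fin N)} (hc : c ∈ C) : ⟪c, x⟫_ℝ ≤ r := by
  have hconv : Convex ℝ {c : EuclideanSpace ℝ (Fin N) | ⟪c, x⟫_ℝ ≤ r} := by
    intro a ha b hb s t hs ht hst
    simp only [Set.mem_ofPred_eq, inner_add_left, real_inner_smul_left] at *
    calc s * ⟪a, x⟫_ℝ + t * ⟪b, x⟫_ℝ ≤ s * r + t * r := by gcongr
      _ = r := by rw [← add_mul, hst, one_mul]
  have hclosed : IsClosed {c : EuclideanSpace ℝ (Fin N) | ⟪c, x⟫_ℝ ≤ r} :=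
    isClosed_le (by fun_prop) continuous_const
  rw [← closure_convexHull_extremePoints hC.isCompact hC.convex] at hc
  exact closure_minimal (convexHull_min h hconv) hclosed hc

theorem exists_forall_norm_le_mem (hC : IsSymmetricPolytope C) :
    ∃ ε > 0, ∀ x : EuclideanSpace ℝ (Fin N), ‖x‖ ≤ ε → x ∈ C := by
  obtain ⟨ε, hε, h⟩ := Metric.nhds_basis_closedBall.mem_iff.1
    (mem_interior_iff_mem_nhds.1 hC.zero_mem_interior)
  exact ⟨ε, hε, fun x hx => h (by simpa using hx)⟩

theorem ne_zero_of_mem_extremePoints (hC : IsSymmetricPolytope C) (hN : 1 ≤ N)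
    {y : EuclideanSpace ℝ (Fin N)} (hy : y ∈ C.extremePoints ℝ) : y ≠ 0 := by
  rintro rfl
  obtain ⟨ε, hε, h⟩ := hC.exists_forall_norm_le_mem
  have hv := h (EuclideanSpace.single ⟨0, hN⟩ ε) (by simp [abs_of_pos hε])
  have hv' := h (-EuclideanSpace.single ⟨0, hN⟩ ε) (by simp [abs_of_pos hε])
  have := hy.2 hv hv' ⟨1 / 2, 1 / 2, by norm_num, by norm_num, by norm_num, by simp⟩
  simp [hε.ne'] at this

theorem mem_polarSet_iff (hC : IsSymmetricPolytope C) {x : EuclideanSpace ℝ (Fin N)} :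
    x ∈ polarSet C ↔ ∀ v ∈ C.extremePoints ℝ, ⟪v, x⟫_ℝ ≤ 1 :=
  ⟨fun h v hv => h v hv.1, fun h _ hc => hC.inner_le_of_forall_extremePoints h hc⟩

theorem convex_polarSet (C : Set (EuclideanSpace ℝ (Fin N))) : Convex ℝ (polarSet C) := by
  intro a ha b hb s t hs ht hst c hc
  rw [inner_add_right, inner_smul_right, inner_smul_right]
  calc s * ⟪c, a⟫_ℝ + t * ⟪c, b⟫_ℝ ≤ s * 1 + t * 1 := by gcongr <;> [exact ha c hc; exact hb c hc]
    _ = 1 := by rw [mul_one, mul_one, hst]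

theorem neg_mem_polarSet (hC : IsSymmetricPolytope C) {x : EuclideanSpace ℝ (Fin N)}
    (hx : x ∈ polarSet C) : -x ∈ polarSet C := by
  intro c hc
  rw [inner_neg_right, ← inner_neg_left]
  exact hx _ (by rw [← hC.symm]; simpa using hc)

theorem isClosed_polarSet (C : Set (EuclideanSpace ℝ (Fin N))) : IsClosed (polarSet C) := by
  have : polarSet C = ⋂ y ∈ C, {z | ⟪y, z⟫_ℝ ≤ 1} := by
    ext
    simp [polarSet]
  rw [this]
  exact isClosed_biInter fun y _ => isClosed_le (by fun_prop) continuous_const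

theorem isCompact_polarSet (hC : IsSymmetricPolytope C) : IsCompact (polarSet C) := by
  obtain ⟨ε, hε, h⟩ := hC.exists_forall_norm_le_mem
  refine (isCompact_closedBall (0 : EuclideanSpace ℝ (Fin N)) ε⁻¹).of_isClosed_subset
    (isClosed_polarSet C) fun x hx => ?_
  rw [mem_closedBall_zero_iff]
  rcases eq_or_ne x 0 with rfl | hx0
  · simpa using hε.le
  have hx' : ‖x‖ ≠ 0 := norm_ne_zero_iff.2 hx0
  -- Testing `x` against the point of `C` of norm `ε` in its own direction gives `ε * ‖x‖ ≤ 1`.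
  have := hx ((ε / ‖x‖) • x) (h _ (by
    rw [norm_smul, norm_div, norm_norm, Real.norm_of_nonneg hε.le, div_mul_cancel₀ _ hx']))
  rw [real_inner_smul_left, real_inner_self_eq_norm_sq] at this
  rw [← one_div, le_div_iff₀ hε]
  calc ‖x‖ * ε = ε / ‖x‖ * ‖x‖ ^ 2 := by field_simp
    _ ≤ 1 := this

theorem zero_mem_interior_polarSet (hC : IsSymmetricPolytope C) :
    (0 : EuclideanSpace ℝ (Fin N)) ∈ interior (polarSet C) := by
  obtain ⟨R, hR0, hR⟩ := hC.isCompact.isBounded.exists_pos_norm_le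
  rw [mem_interior_iff_mem_nhds]
  refine Filter.mem_of_superset (Metric.ball_mem_nhds 0 (inv_pos.2 hR0)) fun x hx c hc => ?_
  calc ⟪c, x⟫_ℝ ≤ ‖c‖ * ‖x‖ := real_inner_le_norm c x
    _ ≤ R * R⁻¹ := by gcongr <;> [exact hR c hc; exact (mem_ball_zero_iff.1 hx).le]
    _ = 1 := mul_inv_cancel₀ hR0.ne'

theorem volume_polarSet_ne_zero (hC : IsSymmetricPolytope C) : volume (polarSet C) ≠ 0 :=
  ((isOpen_interior.measure_pos volume ⟨0, hC.zero_mem_interior_polarSet⟩).trans_le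
    (measure_mono interior_subset)).ne'

theorem volume_polarSet_ne_top (hC : IsSymmetricPolytope C) : volume (polarSet C) ≠ ∞ :=
  hC.isCompact_polarSet.measure_lt_top.ne

end IsSymmetricPolytope

/-! ### Decomposition of the polar into cones over its facets. -/

/-- The part of `C°` on which the linear functional `⟪y, ·⟫` is maximal among the vertices of `C`:
the cone with apex `0` over the facet of `y`. -/
def vertexCone {N : ℕ} (C : Set (EuclideanSpace ℝ (Fin N))) (y : EuclideanSpace ℝ (Fin N)) :
    Set (EuclideanSpace ℝ (Fin N)) :=
  polarSet C ∩ {x | ∀ v ∈ C.extremePoints ℝ, ⟪v, x⟫_ℝ ≤ ⟪y, x⟫_ℝ}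

/-- The fraction of the volume of `C°` taken by the cone over the facet of `y`. -/
noncomputable def coneWeight {N : ℕ} (C : Set (EuclideanSpace ℝ (Fin N)))
    (y : EuclideanSpace ℝ (Fin N)) : ℝ≥0∞ :=
  volume (vertexCone C y) / volume (polarSet C)

namespace IsSymmetricPolytope

variable {N : ℕ} {C : Set (EuclideanSpace ℝ (Fin N))}

theorem isClosed_vertexCone (C : Set (EuclideanSpace ℝ (Fin N))) (y : EuclideanSpace ℝ (Fin N)) :
    IsClosed (vertexCone C y) := by
  have : vertexCone C y =
      polarSet C ∩ ⋂ v ∈ C.extremePoints ℝ, {x | ⟪v, x⟫_ℝ ≤ ⟪y, x⟫_ℝ} := by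
    ext
    simp [vertexCone]
  rw [this]
  exact (isClosed_polarSet C).inter
    (isClosed_biInter fun v _ => isClosed_le (by fun_prop) (by fun_prop))

theorem exists_forall_inner_le (hC : IsSymmetricPolytope C) (x : EuclideanSpace ℝ (Fin N)) :
    ∃ y ∈ C.extremePoints ℝ, ∀ v ∈ C.extremePoints ℝ, ⟪v, x⟫_ℝ ≤ ⟪y, x⟫_ℝ :=
  Set.exists_max_image _ (fun v => ⟪v, x⟫_ℝ) hC.finite_extremePoints hC.nonempty_extremePoints

theorem iUnion_vertexCone (hC : IsSymmetricPolytope C) :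
    ⋃ y : C.extremePoints ℝ, vertexCone C y = polarSet C := by
  refine (Set.iUnion_subset fun y => Set.inter_subset_left).antisymm fun x hx => ?_
  obtain ⟨y, hy, h⟩ := hC.exists_forall_inner_le x
  exact Set.mem_iUnion.2 ⟨⟨y, hy⟩, hx, h⟩

/-- On the overlap both functionals are maximal, so it lies in the hyperplane orthogonal to `y - z`.
-/
theorem aedisjoint_vertexCone {y z : EuclideanSpace ℝ (Fin N)} (hy : y ∈ C.extremePoints ℝ)
    (hz : z ∈ C.extremePoints ℝ) (hyz : y ≠ z) :
    AEDisjoint volume (vertexCone C y) (vertexCone C z) := by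
  have hne : (ℝ ∙ (y - z))ᗮ ≠ ⊤ := by
    rw [Ne, Submodule.orthogonal_eq_top_iff, Submodule.span_singleton_eq_bot]
    exact sub_ne_zero.2 hyz
  refine measure_mono_null (fun x hx => ?_) (Measure.addHaar_submodule volume _ hne)
  rw [SetLike.mem_coe, Submodule.mem_orthogonal_singleton_iff_inner_right, inner_sub_left]
  linarith [hx.1.2 z hz, hx.2.2 y hy]

theorem tsum_volume_vertexCone (hC : IsSymmetricPolytope C) :
    ∑' y : C.extremePoints ℝ, volume (vertexCone C y) = volume (polarSet C) := by
  have := hC.finite_extremePoints.to_subtype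
  rw [← hC.iUnion_vertexCone, measure_iUnion₀]
  · exact fun y z hyz => aedisjoint_vertexCone y.2 z.2 fun h => hyz (Subtype.ext h)
  · exact fun y => (isClosed_vertexCone C y).measurableSet.nullMeasurableSet

/-- Up to the apex, a null set since `N ≥ 1`, this is the cone of `volume_cone`. Away from the apex
the maximal value `⟪y, x⟫` is positive because `C` contains a ball about `0`, so `x` can be rescaled
into the facet. -/
theorem volume_vertexCone (hC : IsSymmetricPolytope C) (hN : 1 ≤ N)
    {y : EuclideanSpace ℝ (Fin N)} (hy : y ∈ C.extremePoints ℝ) :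
    volume (vertexCone C y) = ENNReal.ofReal (facetDistance y) * facetArea C y / N := by
  have := Fin.pos_iff_nonempty.1 hN
  have hF : IsClosed (dualFacet C y) :=
    (isClosed_polarSet C).inter (isClosed_eq (by fun_prop) continuous_const)
  rw [facetArea, ← volume_cone hN (hC.ne_zero_of_mem_extremePoints hN hy) hF.measurableSet
    Set.inter_subset_right]
  set T := {x | 0 < ⟪y, x⟫_ℝ ∧ ⟪y, x⟫_ℝ ≤ 1 ∧ (⟪y, x⟫_ℝ)⁻¹ • x ∈ dualFacet C y}
  refine le_antisymm ?_ (measure_mono ?_)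
  · refine (measure_mono (t := T ∪ {0}) fun x hx => ?_).trans
      ((measure_union_le _ _).trans_eq (by rw [measure_singleton, add_zero]))
    rcases eq_or_ne x 0 with rfl | hx0
    · exact .inr rfl
    obtain ⟨ε, hε, h⟩ := hC.exists_forall_norm_le_mem
    have hx' : ‖x‖ ≠ 0 := norm_ne_zero_iff.2 hx0
    have h1 := hC.inner_le_of_forall_extremePoints hx.2 (h ((ε / ‖x‖) • x) (by
      rw [norm_smul, norm_div, norm_norm, Real.norm_of_nonneg hε.le, div_mul_cancel₀ _ hx']))
    rw [real_inner_smul_left, real_inner_self_eq_norm_sq] at h1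
    have hpos : 0 < ⟪y, x⟫_ℝ := lt_of_lt_of_le (by positivity) h1
    refine .inl ⟨hpos, hx.1 y hy.1, hC.mem_polarSet_iff.2 fun v hv => ?_, ?_⟩
    · rw [inner_smul_right, inv_mul_le_iff₀ hpos, mul_one]
      exact hx.2 v hv
    · rw [dualHyperplane, Set.mem_ofPred_eq, inner_smul_right, inv_mul_cancel₀ hpos.ne']
  · rintro x ⟨hpos, hle, h⟩
    have h1 : ∀ v ∈ C.extremePoints ℝ, ⟪v, x⟫_ℝ ≤ ⟪y, x⟫_ℝ := fun v hv => by
      have := h.1 v hv.1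
      rwa [inner_smul_right, inv_mul_le_iff₀ hpos, mul_one] at this
    exact ⟨hC.mem_polarSet_iff.2 fun v hv => (h1 v hv).trans hle, h1⟩

theorem vertexLaw_eq (hC : IsSymmetricPolytope C) (hN : 1 ≤ N) :
    vertexLaw C = Measure.sum fun y : C.extremePoints ℝ =>
      coneWeight C y • Measure.dirac (y : EuclideanSpace ℝ (Fin N)) := by
  rw [vertexLaw]
  congr 1
  ext1 y
  rw [coneWeight, hC.volume_vertexCone hN y.2]
  congr 1
  rw [div_eq_mul_inv, div_eq_mul_inv, div_eq_mul_inv, ENNReal.mul_inv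
    (.inr hC.volume_polarSet_ne_top) (.inl (ENNReal.natCast_ne_top N)), mul_assoc, mul_assoc, mul_assoc]

theorem sum_coneWeight (hC : IsSymmetricPolytope C) :
    ∑ y ∈ hC.finite_extremePoints.toFinset, coneWeight C y = 1 := by
  have := hC.finite_extremePoints.fintype
  have h := hC.tsum_volume_vertexCone
  rw [tsum_fintype, ← Finset.sum_subtype hC.finite_extremePoints.toFinset (by simp)
    (fun y => volume (vertexCone C y))] at h
  simp_rw [coneWeight, div_eq_mul_inv, ← Finset.sum_mul]
  rw [← ENNReal.mul_inv_cancel hC.volume_polarSet_ne_zero hC.volume_polarSet_ne_top]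
  rw [h]

theorem lintegral_vertexLaw (hC : IsSymmetricPolytope C) (hN : 1 ≤ N)
    (f : EuclideanSpace ℝ (Fin N) → ℝ≥0∞) :
    ∫⁻ y, f y ∂vertexLaw C = ∑ y ∈ hC.finite_extremePoints.toFinset, coneWeight C y * f y := by
  have := hC.finite_extremePoints.fintype
  rw [hC.vertexLaw_eq hN, lintegral_sum_measure, tsum_fintype]
  simp_rw [lintegral_smul_measure, lintegral_dirac, smul_eq_mul]
  exact (Finset.sum_subtype hC.finite_extremePoints.toFinset (by simp)
    (fun y => coneWeight C y * f y)).symm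

theorem isProbabilityMeasure_vertexLaw (hC : IsSymmetricPolytope C) (hN : 1 ≤ N) :
    IsProbabilityMeasure (vertexLaw C) := by
  refine ⟨?_⟩
  rw [← lintegral_one, hC.lintegral_vertexLaw hN]
  simpa using hC.sum_coneWeight

theorem coneWeight_ne_top (hC : IsSymmetricPolytope C) (y : EuclideanSpace ℝ (Fin N)) :
    coneWeight C y ≠ ∞ :=
  ENNReal.div_ne_top ((measure_mono Set.inter_subset_left).trans_lt
    hC.volume_polarSet_ne_top.lt_top).ne hC.volume_polarSet_ne_zero

theorem sum_coneWeight_toReal (hC : IsSymmetricPolytope C) :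
    ∑ y ∈ hC.finite_extremePoints.toFinset, (coneWeight C y).toReal = 1 := by
  rw [← ENNReal.toReal_sum fun y _ => hC.coneWeight_ne_top y, hC.sum_coneWeight,
    ENNReal.toReal_one]

end IsSymmetricPolytope

/-! ### Minkowski's first inequality. -/

namespace IsSymmetricPolytope

variable {N : ℕ} {C : Set (EuclideanSpace ℝ (Fin N))}

/-- If `y` is a vertex maximizing `⟪·, x⟫` at a point `x` of the sum, then `⟪y, x⟫ ≤ α + β * h y`,
which puts `x` in the cone of `y` dilated by that factor. -/
theorem volume_smul_add_smul_le (hC : IsSymmetricPolytope C) {A : Set (EuclideanSpace ℝ (Fin N))}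
    {h : EuclideanSpace ℝ (Fin N) → ℝ} (hA : ∀ y ∈ C.extremePoints ℝ, ∀ z ∈ A, ⟪y, z⟫_ℝ ≤ h y)
    {α β : ℝ} (hα : 0 ≤ α) (hβ : 0 ≤ β) (hpos : ∀ y ∈ C.extremePoints ℝ, 0 < α + β * h y) :
    volume (α • polarSet C + β • A) ≤ ∑ y ∈ hC.finite_extremePoints.toFinset,
      ENNReal.ofReal ((α + β * h y) ^ N) * volume (vertexCone C y) := by
  have hsub : α • polarSet C + β • A ⊆
      ⋃ y ∈ hC.finite_extremePoints.toFinset, (α + β * h y) • vertexCone C y := by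
    rintro _ ⟨_, ⟨k, hk, rfl⟩, _, ⟨z, hz, rfl⟩, rfl⟩
    simp only
    set x := α • k + β • z with hx
    obtain ⟨y, hy, hmax⟩ := hC.exists_forall_inner_le x
    have hc := hpos y hy
    have hle : ⟪y, x⟫_ℝ ≤ α + β * h y := by
      rw [hx, inner_add_right, inner_smul_right, inner_smul_right]
      calc α * ⟪y, k⟫_ℝ + β * ⟪y, z⟫_ℝ ≤ α * 1 + β * h y := by
            gcongr
            · exact hk y hy.1
            · exact hA y hy z hz
        _ = _ := by rw [mul_one]
    refine Set.mem_iUnion₂.2 ⟨y, by simpa using hy, ?_⟩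
    rw [Set.mem_smul_set_iff_inv_smul_mem₀ hc.ne']
    refine ⟨hC.mem_polarSet_iff.2 fun v hv => ?_, fun v hv => ?_⟩
    · rw [inner_smul_right, inv_mul_le_iff₀ hc, mul_one]
      exact (hmax v hv).trans hle
    · rw [inner_smul_right, inner_smul_right]
      exact mul_le_mul_of_nonneg_left (hmax v hv) (inv_nonneg.2 hc.le)
  refine (measure_mono hsub).trans ((measure_biUnion_finset_le _ _).trans
    (Finset.sum_le_sum fun y hy => ?_))
  rw [Measure.addHaar_smul_of_nonneg volume (hpos y (by simpa using hy)).le,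
    finrank_euclideanSpace_fin]

theorem one_le_sum_of_volume_eq (hC : IsSymmetricPolytope C) (hN : 1 ≤ N)
    {A : Set (EuclideanSpace ℝ (Fin N))} (hAc : IsCompact A) (hAv : volume A = volume (polarSet C))
    {h : EuclideanSpace ℝ (Fin N) → ℝ} (hA : ∀ y ∈ C.extremePoints ℝ, ∀ z ∈ A, ⟪y, z⟫_ℝ ≤ h y) :
    1 ≤ ∑ y ∈ hC.finite_extremePoints.toFinset, (coneWeight C y).toReal * h y := by
  set V := hC.finite_extremePoints.toFinset with hV
  -- `g t` bounds the volume of `(1 - t)C° + tA` relative to `C°` from above. Since `g 0 = 1` and,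
  -- by Brunn–Minkowski, `g t ≥ 1` for small `t > 0`, the derivative `N * (∑ w h - 1)` at `0`, with
  -- `w` the cone weights, is nonnegative.
  set g : ℝ → ℝ := fun t => ∑ y ∈ V, (coneWeight C y).toReal * (1 + t * (h y - 1)) ^ N with hg
  have hg0 : g 0 = 1 := by simp [hg, hC.sum_coneWeight_toReal, hV]
  have hderiv : HasDerivAt g
      (∑ y ∈ V, (coneWeight C y).toReal * (N * (1 + 0 * (h y - 1)) ^ (N - 1) * (h y - 1))) 0 := by
    refine HasDerivAt.fun_sum fun y _ => HasDerivAt.const_mul _ ?_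
    refine HasDerivAt.fun_pow ?_ N
    simpa using ((hasDerivAt_id (0 : ℝ)).mul_const (h y - 1)).const_add 1
  have hev : ∀ᶠ t in nhdsWithin (0 : ℝ) (Set.Ioi 0), 1 ≤ g t := by
    have h1 : ∀ y ∈ V, ∀ᶠ t in nhdsWithin (0 : ℝ) (Set.Ioi 0), 0 < 1 + t * (h y - 1) := by
      intro y _
      have hcont : Filter.Tendsto (fun t : ℝ => 1 + t * (h y - 1)) (nhds 0) (nhds 1) := by
        have : Continuous fun t : ℝ => 1 + t * (h y - 1) := by fun_prop
        simpa using this.tendsto 0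
      exact (hcont.eventually (lt_mem_nhds one_pos)).filter_mono nhdsWithin_le_nhds
    have h2 : ∀ᶠ t in nhdsWithin (0 : ℝ) (Set.Ioi 0), t < 1 :=
      (gt_mem_nhds one_pos).filter_mono nhdsWithin_le_nhds
    filter_upwards [(Filter.eventually_all_finset V).2 h1, h2, self_mem_nhdsWithin] with t ht ht1 ht0
    have heq : ∀ y, (1 - t) + t * h y = 1 + t * (h y - 1) := fun y => by ring
    have hpos : ∀ y ∈ C.extremePoints ℝ, 0 < (1 - t) + t * h y := fun y hy => by
      rw [heq]
      exact ht y (by simpa [hV] using hy)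
    have hbm := (brunnMinkowski hC.isCompact_polarSet hAc (sub_pos.2 ht1) ht0
      (sub_add_cancel 1 t)).trans
      (hC.volume_smul_add_smul_le hA (sub_pos.2 ht1).le (le_of_lt ht0) hpos)
    rw [hAv, ← ENNReal.rpow_add_of_nonneg _ _ (sub_pos.2 ht1).le (le_of_lt ht0), sub_add_cancel,
      ENNReal.rpow_one] at hbm
    have hdiv := ENNReal.div_le_div_right hbm (volume (polarSet C))
    rw [ENNReal.div_self hC.volume_polarSet_ne_zero hC.volume_polarSet_ne_top, div_eq_mul_inv,
      Finset.sum_mul] at hdiv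
    simp_rw [mul_assoc, ← div_eq_mul_inv, heq] at hdiv
    change 1 ≤ ∑ y ∈ V, ENNReal.ofReal ((1 + t * (h y - 1)) ^ N) * coneWeight C y at hdiv
    have hfin : ∀ y ∈ V, ENNReal.ofReal ((1 + t * (h y - 1)) ^ N) * coneWeight C y ≠ ∞ :=
      fun y _ => ENNReal.mul_ne_top ENNReal.ofReal_ne_top (hC.coneWeight_ne_top y)
    have hreal := (ENNReal.toReal_le_toReal ENNReal.one_ne_top (ENNReal.sum_ne_top.2 hfin)).2 hdiv
    rw [ENNReal.toReal_one, ENNReal.toReal_sum hfin] at hreal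
    refine hreal.trans_eq (Finset.sum_congr rfl fun y hy => ?_)
    rw [ENNReal.toReal_mul, ENNReal.toReal_ofReal (pow_nonneg (ht y hy).le N), mul_comm]
  have hslope := ge_of_tendsto hderiv.tendsto_slope_zero_right (b := 0) (by
    filter_upwards [hev, self_mem_nhdsWithin] with t ht ht0
    rw [zero_add, hg0, smul_eq_mul]
    exact mul_nonneg (inv_nonneg.2 (le_of_lt ht0)) (sub_nonneg.2 ht))
  have hsum : ∑ y ∈ V, (coneWeight C y).toReal * (N * (1 + 0 * (h y - 1)) ^ (N - 1) * (h y - 1)) =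
      N * (∑ y ∈ V, (coneWeight C y).toReal * h y - 1) := by
    have h1 : ∑ y ∈ V, (coneWeight C y).toReal = 1 := hC.sum_coneWeight_toReal
    rw [mul_sub, mul_one, Finset.mul_sum]
    nth_rw 3 [← mul_one (N : ℝ)]
    rw [← h1, Finset.mul_sum, ← Finset.sum_sub_distrib]
    refine Finset.sum_congr rfl fun y _ => ?_
    rw [h1, zero_mul, add_zero, one_pow]
    ring
  rw [hsum] at hslope
  have hN' : (0 : ℝ) < N := by exact_mod_cast hN
  linarith [nonneg_of_mul_nonneg_right hslope hN']

/-- **Minkowski's first inequality** for a compact set and the polytope `C°`. -/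
theorem volume_le_of_isCompact (hC : IsSymmetricPolytope C) (hN : 1 ≤ N)
    {A : Set (EuclideanSpace ℝ (Fin N))} (hAc : IsCompact A)
    {h : EuclideanSpace ℝ (Fin N) → ℝ} (hA : ∀ y ∈ C.extremePoints ℝ, ∀ z ∈ A, ⟪y, z⟫_ℝ ≤ h y) :
    volume A ≤ ENNReal.ofReal
      (∑ y ∈ hC.finite_extremePoints.toFinset, (coneWeight C y).toReal * h y) ^ N *
        volume (polarSet C) := by
  by_cases hA0 : volume A = 0
  · rw [hA0]
    exact zero_le
  have hN0 : N ≠ 0 := by omega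
  have hAt : volume A ≠ ∞ := hAc.measure_lt_top.ne
  have hKt := hC.volume_polarSet_ne_top
  have hK0 := hC.volume_polarSet_ne_zero
  set q : ℝ := (volume A / volume (polarSet C)).toReal with hq
  have hq0 : 0 < q := ENNReal.toReal_pos (ENNReal.div_ne_zero.2 ⟨hA0, hKt⟩)
    (ENNReal.div_ne_top hAt hK0)
  have hqv : volume A = ENNReal.ofReal q * volume (polarSet C) := by
    rw [hq, ENNReal.ofReal_toReal (ENNReal.div_ne_top hAt hK0), ENNReal.div_mul_cancel hK0 hKt]
  -- `ρ` is the dilation factor for which `ρ • C°` has the volume of `A`.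
  obtain ⟨ρ, hρ0, hρ⟩ : ∃ ρ : ℝ, 0 < ρ ∧ ρ ^ N = q :=
    ⟨q ^ (N⁻¹ : ℝ), Real.rpow_pos_of_pos hq0 _, Real.rpow_inv_natCast_pow hq0.le hN0⟩
  have hv : volume (ρ⁻¹ • A) = volume (polarSet C) := by
    rw [Measure.addHaar_smul_of_nonneg volume (inv_nonneg.2 hρ0.le), finrank_euclideanSpace_fin,
      inv_pow, hρ, hqv, ← mul_assoc, ← ENNReal.ofReal_mul (inv_nonneg.2 hq0.le),
      inv_mul_cancel₀ hq0.ne', ENNReal.ofReal_one, one_mul]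
  have key := hC.one_le_sum_of_volume_eq hN (hAc.smul ρ⁻¹) hv (h := fun y => ρ⁻¹ * h y) (by
    rintro y hy _ ⟨z, hz, rfl⟩
    simp only [inner_smul_right]
    exact mul_le_mul_of_nonneg_left (hA y hy z hz) (inv_nonneg.2 hρ0.le))
  simp_rw [mul_left_comm _ ρ⁻¹] at key
  rw [← Finset.mul_sum, ← div_eq_inv_mul, one_le_div hρ0] at key
  rw [hqv, ← hρ, ENNReal.ofReal_pow hρ0.le]
  gcongr

/-- `A` may be unbounded or nonmeasurable, so it is enlarged to a closed polyhedron, which is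
exhausted by compact sets. Vertices of weight zero carry no constraint; on a compact set of radius
`R` they get the bound `‖y‖ * R`, which does not change the weighted sum. -/
theorem volume_le (hC : IsSymmetricPolytope C) (hN : 1 ≤ N)
    {A : Set (EuclideanSpace ℝ (Fin N))} {h : EuclideanSpace ℝ (Fin N) → ℝ}
    (hA : ∀ y ∈ C.extremePoints ℝ, coneWeight C y ≠ 0 → ∀ z ∈ A, ⟪y, z⟫_ℝ ≤ h y) :
    volume A ≤ ENNReal.ofReal
      (∑ y ∈ hC.finite_extremePoints.toFinset, (coneWeight C y).toReal * h y) ^ N *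
        volume (polarSet C) := by
  classical
  set B : Set (EuclideanSpace ℝ (Fin N)) :=
    ⋂ y ∈ C.extremePoints ℝ, ⋂ _ : coneWeight C y ≠ 0, {z | ⟪y, z⟫_ℝ ≤ h y} with hB
  have hBc : IsClosed B := isClosed_biInter fun y _ => isClosed_iInter fun _ =>
    isClosed_le (by fun_prop) continuous_const
  have hAB : A ⊆ B := fun z hz => by
    simp only [hB, Set.mem_iInter]
    exact fun y hy hy0 => hA y hy hy0 z hz
  refine (measure_mono hAB).trans ?_
  rw [hBc.measurableSet.measure_eq_iSup_isCompact]
  refine iSup₂_le fun L hLB => iSup_le fun hL => ?_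
  obtain ⟨R, hR⟩ := hL.isBounded.exists_norm_le
  refine (hC.volume_le_of_isCompact hN hL
    (h := fun y => if coneWeight C y = 0 then ‖y‖ * R else h y) fun y hy z hz => ?_).trans_eq ?_
  · split_ifs with h0
    · exact (real_inner_le_norm y z).trans (by gcongr; exact hR z hz)
    · have := hLB hz
      simp only [hB, Set.mem_iInter] at this
      exact this y hy h0
  · congr 3
    refine Finset.sum_congr rfl fun y _ => ?_
    split_ifs with h0
    · simp [h0]
    · rfl

end IsSymmetricPolytope

/-! ### Support function and its expectation. -/

/-- The support function of `A` with values in the extended reals. -/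
noncomputable def supportFunction {N : ℕ} (A : Set (EuclideanSpace ℝ (Fin N)))
    (y : EuclideanSpace ℝ (Fin N)) : EReal :=
  ⨆ z ∈ A, ((⟪z, y⟫_ℝ : ℝ) : EReal)

theorem measurable_supportFunction {N : ℕ} (A : Set (EuclideanSpace ℝ (Fin N))) :
    Measurable (supportFunction A) :=
  (lowerSemicontinuous_biSup fun z _ => Continuous.lowerSemicontinuous
    (continuous_coe_real_ereal.comp (by fun_prop))).measurable

theorem supportFunction_ne_bot {N : ℕ} {A : Set (EuclideanSpace ℝ (Fin N))} (hA : A.Nonempty)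
    (y : EuclideanSpace ℝ (Fin N)) : supportFunction A y ≠ ⊥ := by
  obtain ⟨z, hz⟩ := hA
  have : ((⟪z, y⟫_ℝ : ℝ) : EReal) ≤ supportFunction A y :=
    le_iSup₂ (f := fun z (_ : z ∈ A) => ((⟪z, y⟫_ℝ : ℝ) : EReal)) z hz
  exact ((EReal.bot_lt_coe _).trans_le this).ne'

theorem inner_le_toReal_supportFunction {N : ℕ} {A : Set (EuclideanSpace ℝ (Fin N))}
    {y z : EuclideanSpace ℝ (Fin N)} (hy : supportFunction A y ≠ ⊤) (hz : z ∈ A) :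
    ⟪y, z⟫_ℝ ≤ (supportFunction A y).toReal := by
  have : ((⟪z, y⟫_ℝ : ℝ) : EReal) ≤ supportFunction A y :=
    le_iSup₂ (f := fun z (_ : z ∈ A) => ((⟪z, y⟫_ℝ : ℝ) : EReal)) z hz
  rw [real_inner_comm, ← EReal.toReal_coe ⟪z, y⟫_ℝ]
  exact EReal.toReal_le_toReal this (EReal.coe_ne_bot _) hy

theorem EReal.toReal_toENNReal_sub {x : EReal} (hx : x ≠ ⊤) (hx' : x ≠ ⊥) :
    x.toENNReal.toReal - (-x).toENNReal.toReal = x.toReal := by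
  lift x to ℝ using ⟨hx, hx'⟩
  rw [← EReal.coe_neg, EReal.real_coe_toENNReal, EReal.real_coe_toENNReal,
    ENNReal.toReal_ofReal', ENNReal.toReal_ofReal', EReal.toReal_coe]
  exact max_zero_sub_max_neg_zero_eq_self x

namespace IsSymmetricPolytope

variable {N : ℕ} {C : Set (EuclideanSpace ℝ (Fin N))}

theorem extExpectation_eq (hC : IsSymmetricPolytope C) (hN : 1 ≤ N) {Ω : Type*}
    [MeasurableSpace Ω] {P : Measure Ω} {Y : Ω → EuclideanSpace ℝ (Fin N)}
    (hY : HasLaw Y (vertexLaw C) P) {f : EuclideanSpace ℝ (Fin N) → EReal} (hf : Measurable f) :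
    extExpectation P (fun ω => f (Y ω)) =
      ((∑ y ∈ hC.finite_extremePoints.toFinset, coneWeight C y * (f y).toENNReal : ℝ≥0∞) : EReal) -
      ((∑ y ∈ hC.finite_extremePoints.toFinset, coneWeight C y * (-f y).toENNReal : ℝ≥0∞) :
        EReal) := by
  have hneg : Measurable fun y => (-f y).toENNReal := hf.neg.ereal_toENNReal
  rw [extExpectation, ← hC.lintegral_vertexLaw hN, ← hC.lintegral_vertexLaw hN,
    ← hY.lintegral_comp hf.ereal_toENNReal.aemeasurable, ← hY.lintegral_comp hneg.aemeasurable]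

theorem sum_coneWeight_mul_ne_top (hC : IsSymmetricPolytope C)
    {f : EuclideanSpace ℝ (Fin N) → ℝ≥0∞}
    (hf : ∀ y ∈ C.extremePoints ℝ, coneWeight C y ≠ 0 → f y ≠ ∞) :
    ∀ y ∈ hC.finite_extremePoints.toFinset, coneWeight C y * f y ≠ ∞ := by
  intro y hy
  by_cases h0 : coneWeight C y = 0
  · simp [h0]
  · exact ENNReal.mul_ne_top (hC.coneWeight_ne_top y) (hf y (by simpa using hy) h0)

theorem extExpectation_eq_top (hC : IsSymmetricPolytope C) (hN : 1 ≤ N) {Ω : Type*}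
    [MeasurableSpace Ω] {P : Measure Ω} {Y : Ω → EuclideanSpace ℝ (Fin N)}
    (hY : HasLaw Y (vertexLaw C) P) {f : EuclideanSpace ℝ (Fin N) → EReal} (hf : Measurable f)
    (hbot : ∀ y, f y ≠ ⊥) {y : EuclideanSpace ℝ (Fin N)} (hy : y ∈ C.extremePoints ℝ)
    (hy0 : coneWeight C y ≠ 0) (hyf : f y = ⊤) :
    extExpectation P (fun ω => f (Y ω)) = ⊤ := by
  rw [hC.extExpectation_eq hN hY hf]
  have h1 : ∑ y ∈ hC.finite_extremePoints.toFinset, coneWeight C y * (f y).toENNReal = ∞ :=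
    ENNReal.sum_eq_top.2 ⟨y, by simpa using hy, by simp [hyf, ENNReal.mul_top hy0]⟩
  -- The negative part stays finite because `f` avoids `⊥`, so no `∞ - ∞` arises.
  have h2 : ∑ y ∈ hC.finite_extremePoints.toFinset, coneWeight C y * (-f y).toENNReal ≠ ∞ :=
    ENNReal.sum_ne_top.2 (hC.sum_coneWeight_mul_ne_top fun y _ _ => by simp [hbot y])
  rw [h1, ← ENNReal.ofReal_toReal h2, EReal.coe_ennreal_ofReal, EReal.coe_ennreal_top,
    EReal.top_sub_coe]

theorem extExpectation_eq_coe (hC : IsSymmetricPolytope C) (hN : 1 ≤ N) {Ω : Type*}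
    [MeasurableSpace Ω] {P : Measure Ω} {Y : Ω → EuclideanSpace ℝ (Fin N)}
    (hY : HasLaw Y (vertexLaw C) P) {f : EuclideanSpace ℝ (Fin N) → EReal} (hf : Measurable f)
    (hbot : ∀ y, f y ≠ ⊥) (htop : ∀ y ∈ C.extremePoints ℝ, coneWeight C y ≠ 0 → f y ≠ ⊤) :
    extExpectation P (fun ω => f (Y ω)) =
      ((∑ y ∈ hC.finite_extremePoints.toFinset, (coneWeight C y).toReal * (f y).toReal : ℝ) :
        EReal) := by
  rw [hC.extExpectation_eq hN hY hf]
  have h1 := hC.sum_coneWeight_mul_ne_top (f := fun y => (f y).toENNReal)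
    fun y hy hy0 => by simpa using htop y hy hy0
  have h2 := hC.sum_coneWeight_mul_ne_top (f := fun y => (-f y).toENNReal)
    fun y _ _ => by simp [hbot y]
  rw [← EReal.coe_ennreal_toReal (ENNReal.sum_ne_top.2 h1),
    ← EReal.coe_ennreal_toReal (ENNReal.sum_ne_top.2 h2), ← EReal.coe_sub,
    ENNReal.toReal_sum h1, ENNReal.toReal_sum h2, ← Finset.sum_sub_distrib]
  congr 1
  refine Finset.sum_congr rfl fun y hy => ?_
  rw [ENNReal.toReal_mul, ENNReal.toReal_mul, ← mul_sub]
  by_cases hy0 : coneWeight C y = 0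
  · simp [hy0]
  · rw [EReal.toReal_toENNReal_sub (htop y (by simpa using hy) hy0) (hbot y)]

/-! ### Packing bound. -/

/-- Two points of a packing for the norm with unit ball `C°` have disjoint balls of half the
packing radius. -/
theorem disjoint_vadd_smul_polarSet (hC : IsSymmetricPolytope C)
    {x y : EuclideanSpace ℝ (Fin N)} {l : ℝ} (hl : 0 < l)
    (hxy : l < gauge (polarSet C) (x - y)) :
    Disjoint (x +ᵥ (l / 2) • polarSet C) (y +ᵥ (l / 2) • polarSet C) := by
  rw [Set.disjoint_left]
  rintro _ ⟨_, ⟨k, hk, rfl⟩, rfl⟩ ⟨_, ⟨k', hk', rfl⟩, h⟩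
  -- A common point gives `x - y = (l / 2) • (k' - k)`, which is `l` times the midpoint of `k'` and
  -- `-k`.
  refine hxy.not_ge (gauge_le_of_mem hl.le ⟨(1 / 2 : ℝ) • k' + (1 / 2 : ℝ) • -k,
    convex_polarSet C hk' (hC.neg_mem_polarSet hk) (by norm_num) (by norm_num) (by norm_num), ?_⟩)
  simp only [vadd_eq_add] at h ⊢
  have : x - y = (l / 2) • k' - (l / 2) • k := by
    rw [sub_eq_sub_iff_add_eq_add, ← h]
    abel
  rw [this]
  module

theorem volume_biUnion_vadd (hC : IsSymmetricPolytope C) {l : ℝ} (hl : 0 < l)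
    (T : Finset (EuclideanSpace ℝ (Fin N)))
    (hT : (T : Set (EuclideanSpace ℝ (Fin N))).Pairwise
      fun x y => l < gauge (polarSet C) (x - y)) :
    volume (⋃ x ∈ T, x +ᵥ (l / 2) • polarSet C) =
      T.card * (ENNReal.ofReal (l / 2) ^ N * volume (polarSet C)) := by
  have hm : MeasurableSet ((l / 2) • polarSet C) :=
    (hC.isCompact_polarSet.smul (l / 2)).measurableSet
  rw [measure_biUnion_finset
    (fun x hx y hy hxy => hC.disjoint_vadd_smul_polarSet hl (hT hx hy hxy))
    fun x _ => hm.const_vadd x]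
  simp_rw [measure_vadd]
  rw [Finset.sum_const, nsmul_eq_mul, Measure.addHaar_smul_of_nonneg volume (by positivity),
    finrank_euclideanSpace_fin, ENNReal.ofReal_pow (by positivity)]

theorem card_le_of_packing (hC : IsSymmetricPolytope C) (hN : 1 ≤ N)
    {A : Set (EuclideanSpace ℝ (Fin N))} {h : EuclideanSpace ℝ (Fin N) → ℝ}
    (hA : ∀ y ∈ C.extremePoints ℝ, coneWeight C y ≠ 0 → ∀ z ∈ A, ⟪y, z⟫_ℝ ≤ h y) {r l : ℝ}
    (hr : r = ∑ y ∈ hC.finite_extremePoints.toFinset, (coneWeight C y).toReal * h y)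
    (hl : 0 < l) {T : Finset (EuclideanSpace ℝ (Fin N))} (hTA : ↑T ⊆ A) (hT0 : T.Nonempty)
    (hT : (T : Set (EuclideanSpace ℝ (Fin N))).Pairwise
      fun x y => l < gauge (polarSet C) (x - y)) :
    (T.card : ℝ) ≤ (1 + 2 * r / l) ^ N := by
  have hsum : ∑ y ∈ hC.finite_extremePoints.toFinset, (coneWeight C y).toReal * (h y + l / 2) =
      r + l / 2 := by
    simp_rw [mul_add, Finset.sum_add_distrib, ← Finset.sum_mul]
    rw [hC.sum_coneWeight_toReal, hr, one_mul]
  have hvol := hC.volume_le hN (A := ⋃ x ∈ T, x +ᵥ (l / 2) • polarSet C)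
    (h := fun y => h y + l / 2) (by
      rintro y hy hy0 z hz
      obtain ⟨x, hx, _, ⟨k, hk, rfl⟩, rfl⟩ := Set.mem_iUnion₂.1 hz
      simp only [vadd_eq_add, inner_add_right, inner_smul_right]
      refine add_le_add (hA y hy hy0 x (hTA hx)) ?_
      exact mul_le_of_le_one_right (by positivity) (hk y hy.1))
  rw [hC.volume_biUnion_vadd hl T hT, hsum, ← mul_assoc,
    ENNReal.mul_le_mul_iff_left hC.volume_polarSet_ne_zero hC.volume_polarSet_ne_top] at hvol
  -- `r` may be negative, but a nonpositive `r + l / 2` would make the volume bound `0`, whereas a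
  -- nonempty packing has positive volume.
  have hpos : 0 < r + l / 2 := by
    by_contra hneg
    rw [ENNReal.ofReal_of_nonpos (not_lt.1 hneg), zero_pow (by omega)] at hvol
    have h1 : (T.card : ℝ≥0∞) ≠ 0 := by simpa using hT0.ne_empty
    have h2 : ENNReal.ofReal (l / 2) ^ N ≠ 0 := pow_ne_zero _ (by simpa using hl)
    exact mul_ne_zero h1 h2 (le_zero_iff.1 hvol)
  have hreal := ENNReal.toReal_mono (by simp) hvol
  rw [ENNReal.toReal_mul, ENNReal.toReal_natCast, ENNReal.toReal_pow, ENNReal.toReal_pow,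
    ENNReal.toReal_ofReal (by positivity), ENNReal.toReal_ofReal hpos.le] at hreal
  have : 1 + 2 * r / l = (r + l / 2) / (l / 2) := by
    field_simp
    ring
  rw [this, div_pow, le_div_iff₀ (by positivity)]
  exact hreal

theorem convexPackingNumber_le (hC : IsSymmetricPolytope C) (hN : 1 ≤ N)
    {A : Set (EuclideanSpace ℝ (Fin N))} (hA0 : A.Nonempty)
    {h : EuclideanSpace ℝ (Fin N) → ℝ}
    (hA : ∀ y ∈ C.extremePoints ℝ, coneWeight C y ≠ 0 → ∀ z ∈ A, ⟪y, z⟫_ℝ ≤ h y) {r l : ℝ}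
    (hr : r = ∑ y ∈ hC.finite_extremePoints.toFinset, (coneWeight C y).toReal * h y)
    (hl : 0 < l) :
    ((convexPackingNumber (polarSet C) l A : ℝ≥0∞) : EReal) ≤
      (((1 + 2 * r / l) ^ N : ℝ) : EReal) := by
  have hnonneg : 0 ≤ (1 + 2 * r / l) ^ N := by
    obtain ⟨x, hx⟩ := hA0
    have := hC.card_le_of_packing hN hA hr hl (T := {x}) (by simpa using hx)
      (Finset.singleton_nonempty x) (by simp)
    exact le_trans (by positivity) this
  -- A larger packing, even an infinite one, would contain a finite one with exactly one point more
  -- than the floor.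
  have hle : convexPackingNumber (polarSet C) l A ≤ (⌊(1 + 2 * r / l) ^ N⌋₊ : ℕ∞) := by
    refine iSup_le fun S => iSup₂_le fun hSA hS => ?_
    by_contra hlt
    obtain ⟨T, hTS, hT⟩ := Set.exists_subset_encard_eq (Order.add_one_le_of_lt (not_le.1 hlt))
    have hTfin : T.Finite := Set.finite_of_encard_eq_coe (k := ⌊(1 + 2 * r / l) ^ N⌋₊ + 1)
      (by simpa using hT)
    lift T to Finset (EuclideanSpace ℝ (Fin N)) using hTfin
    rw [Set.encard_coe_eq_coe_finsetCard] at hT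
    have hcard : T.card = ⌊(1 + 2 * r / l) ^ N⌋₊ + 1 := by exact_mod_cast hT
    have := hC.card_le_of_packing hN hA hr hl (hTS.trans hSA)
      (Finset.card_pos.1 (by omega)) (hS.mono hTS)
    have := Nat.le_floor this
    omega
  have hle' : ((convexPackingNumber (polarSet C) l A : ℕ∞) : ℝ≥0∞) ≤
      ENNReal.ofReal ((1 + 2 * r / l) ^ N) := by
    refine (ENat.toENNReal_le.2 hle).trans ?_
    rw [ENat.toENNReal_coe, ← ENNReal.ofReal_natCast]
    exact ENNReal.ofReal_le_ofReal (Nat.floor_le hnonneg)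
  refine (EReal.coe_ennreal_le_coe_ennreal_iff.2 hle').trans_eq ?_
  rw [EReal.coe_ennreal_ofReal, max_eq_left hnonneg]

end IsSymmetricPolytope

/-! ### Assembly of the theorem. -/

theorem EReal.one_add_two_mul_div_pow_top {l : ℝ} (hl : 0 < l) {N : ℕ} (hN : 1 ≤ N) :
    (1 + 2 * (⊤ : EReal) / l) ^ N = ⊤ := by
  have hpow : ∀ n : ℕ, (⊤ : EReal) ^ (n + 1) = ⊤ := by
    intro n
    induction n with
    | zero => rw [zero_add, pow_one]
    | succ n ih => rw [pow_succ, ih, EReal.top_mul_top]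
  obtain ⟨n, rfl⟩ := Nat.exists_eq_add_of_le' hN
  have h2 : (2 : EReal) * ⊤ = ⊤ := EReal.mul_top_of_pos two_pos
  rw [h2, EReal.top_div_of_pos_ne_top (by exact_mod_cast hl) (EReal.coe_ne_top l)]
  have h1 : (1 : EReal) + ⊤ = ⊤ := by
    rw [← EReal.coe_one]
    exact EReal.coe_add_top 1
  rw [h1, hpow]

theorem mainTheorem2 {N : ℕ} (hN : 1 ≤ N) (C : Set (EuclideanSpace ℝ (Fin N)))
    (hC : IsSymmetricPolytope C) :
    IsProbabilityMeasure (vertexLaw C) ∧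
    ∀ {Ω : Type*} [MeasurableSpace Ω] (P : Measure Ω) (Y : Ω → EuclideanSpace ℝ (Fin N)),
      HasLaw Y (vertexLaw C) P →
      ∀ A : Set (EuclideanSpace ℝ (Fin N)), A.Nonempty →
      ∀ a : EReal, a = extExpectation P (fun ω => ⨆ z ∈ A, ((⟪z, Y ω⟫_ℝ : ℝ) : EReal)) →
        (∀ r : ℝ, a = r → volume A ≤ volume (r • polarSet C)) ∧
        ∀ l : ℝ, 0 < l →
          ((convexPackingNumber (polarSet C) l A : ℝ≥0∞) : EReal) ≤ (1 + 2 * a / l) ^ N := by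
  refine ⟨hC.isProbabilityMeasure_vertexLaw hN, ?_⟩
  intro Ω _ P Y hY A hA a ha
  change a = extExpectation P (fun ω => supportFunction A (Y ω)) at ha
  -- An infinite support value matters only at a vertex of positive weight, where it forces `a = ⊤`;
  -- otherwise `a` is a finite real sum.
  by_cases htop : ∀ y ∈ C.extremePoints ℝ, coneWeight C y ≠ 0 → supportFunction A y ≠ ⊤
  · rw [hC.extExpectation_eq_coe hN hY (measurable_supportFunction A) (supportFunction_ne_bot hA) htop] at ha
    set r : ℝ := ∑ y ∈ hC.finite_extremePoints.toFinset,
      (coneWeight C y).toReal * (supportFunction A y).toReal with hr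
    have hle : ∀ y ∈ C.extremePoints ℝ, coneWeight C y ≠ 0 → ∀ z ∈ A,
        ⟪y, z⟫_ℝ ≤ (supportFunction A y).toReal := fun y hy hy0 z hz =>
      inner_le_toReal_supportFunction (htop y hy hy0) hz
    subst ha
    refine ⟨fun s hs => ?_, fun l hl => ?_⟩
    -- The volume of `r • C°` involves `|r|`, so `r ≤ |r|` suffices whatever the sign of `r`.
    · rw [← EReal.coe_injective hs, Measure.addHaar_smul, finrank_euclideanSpace_fin, abs_pow,
        ENNReal.ofReal_pow (abs_nonneg r)]
      refine (hC.volume_le hN hle).trans ?_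
      gcongr
      exact le_abs_self r
    · refine (hC.convexPackingNumber_le hN hA hle hr hl).trans_eq ?_
      rw [EReal.coe_pow, EReal.coe_add, EReal.coe_div, EReal.coe_mul, EReal.coe_one]
      rfl
  · push Not at htop
    obtain ⟨y, hy, hy0, hyf⟩ := htop
    rw [hC.extExpectation_eq_top hN hY (measurable_supportFunction A) (supportFunction_ne_bot hA) hy hy0
      hyf] at ha
    subst ha
    refine ⟨fun s hs => absurd hs.symm (EReal.coe_ne_top s), fun l hl => ?_⟩
    rw [EReal.one_add_two_mul_div_pow_top hl hN]
    exact le_top
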